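/- Let $\Omega_1,\dots,\Omega_m\subset\mathbb{R}^2$ $(m\ge 0)$ be bounded domains (nonempty, open, connected sets), and suppose that their exterior $E=\mathbb{R}^2\setminus\overline{\bigcup_{i=1}^m\Omega_i}$ is connected. Let $k\neq 0$ be a real number. Suppose that $u=(u_1,u_2):E\to\mathbb{C}^2$ is of class $C^2$ and satisfies the oscillatory Stokes equations in $E$, that is, there is a pressure $p:E\to\mathbb{C}$ of class $C^1$ such that $$\Delta u+k^2u=\nabla p,\qquad \nabla\cdot u=0\qquad\text{in }E,$$ and that $$\lim_{r\to\infty}\int_{|y|=r}|u|^2\,dS=0,$$ where $dS$ is arc length and $|u|^2=|u_1|^2+|u_2|^2$. Then each component $u_1,u_2$ of $u$ is harmonic in $E$. -/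

import Mathlib

/-- The plane `ℝ²` with its Euclidean norm. -/
abbrev Plane : Type := EuclideanSpace ℝ (Fin 2)

/-- The partial derivative `∂f/∂x_j` at `x` of a complex-valued function on the plane. -/
noncomputable def partialDeriv (j : Fin 2) (f : Plane → ℂ) (x : Plane) : ℂ :=
  fderiv ℝ f x (EuclideanSpace.single j (1 : ℝ))

/-- `(u, p)` is a classical solution of the oscillatory Stokes equations
`Δu + k²u = ∇p`, `∇ · u = 0` in the open set `E`: the velocity `u` is `C²` in `E`,
the pressure `p` is `C¹` in `E`, and the equations hold pointwise in `E`. -/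
structure IsOscillatoryStokes (k : ℂ) (E : Set Plane)
    (u : Plane → EuclideanSpace ℂ (Fin 2)) (p : Plane → ℂ) : Prop where
  contDiffOn_velocity : ContDiffOn ℝ 2 u E
  contDiffOn_pressure : ContDiffOn ℝ 1 p E
  momentum : ∀ x ∈ E, ∀ j : Fin 2,
    Laplacian.laplacian (fun y : Plane => u y j) x + k ^ 2 * u x j = partialDeriv j p x
  divergence_free : ∀ x ∈ E, ∑ j : Fin 2, partialDeriv j (fun y : Plane => u y j) x = 0

/-- The exterior `ℝ² \ closure (⋃ᵢ Ωᵢ)` of a family of sets in the plane. -/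
def exteriorOf {ι : Type*} (Ω : ι → Set Plane) : Set Plane :=
  (closure (⋃ i, Ω i))ᶜ

/-- The arc length integral `∫_{|y| = r} f dS` over the circle of radius `r > 0` about the origin,
computed with the parametrization `θ ↦ (r cos θ, r sin θ)`, for which `dS = r dθ`. -/
noncomputable def circleArcIntegral (f : Plane → ℝ) (r : ℝ) : ℝ :=
  ∫ θ in (0 : ℝ)..2 * Real.pi, f (!₂[r * Real.cos θ, r * Real.sin θ]) * r

open Filter Topology Set

/-! The pressure gradient is harmonic, so with h = k⁻²∇p each component of u splits as w + h_j,
where h_j is harmonic and Δw + k²w = 0. The point is that w = 0.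

Outside a large disc, expand in angular Fourier modes. Those of w solve a Bessel-type equation,
whose solutions are O(r^{-1/2}) and vanish identically once they are o(r^{-1/2})
(`IsRadialMode.liouville`, `oscillator_energy`). Those of h_j are combinations of r^n and r^{-n}, or
of log r and 1. The decay of u makes the sum of the two o(r^{-1/2}). Hence the harmonic mode is
O(r^{-1/2}), which for these explicit functions already forces o(r^{-1/2}); so the mode of w is
o(r^{-1/2}) too and vanishes (`IsRadialMode.eq_zero_of_tendsto_add`). Thus w = 0 near infinity, and
unique continuation (`IsHelmholtz.eq_zero_of_eventually`) carries this through the connected set E.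

Since p is only C¹, the divergence of the momentum equation cannot be taken classically. Instead, a
local stream function yields a harmonic conjugate of p, and the Cauchy–Riemann equations give the
regularity (`IsOscillatoryStokes.harmonicOnNhd_partialDeriv_pressure`). -/

/-! ### Radial ordinary differential equations -/

/-- `y`, with derivative `g`, solves `y'' + y' / r + (lam - μ / r²) y = 0` on `s`. -/
structure IsRadialMode (lam μ : ℝ) (s : Set ℝ) (y g : ℝ → ℝ) : Prop where
  deriv_fst : ∀ r ∈ s, HasDerivAt y (g r) r
  deriv_snd : ∀ r ∈ s, HasDerivAt g ((μ / r ^ 2 - lam) * y r - g r / r) r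

/-- A radial mode on `(0, R)` which vanishes near `0` vanishes identically. -/
theorem IsRadialMode.eq_zero_of_eq_zero_near {lam μ ρ R : ℝ} {y g : ℝ → ℝ}
    (h : IsRadialMode lam μ (Ioo 0 R) y g) (hρ : 0 < ρ) (hy : ∀ r ∈ Ioo 0 ρ, y r = 0) :
    ∀ r ∈ Ioo 0 R, y r = 0 := by
  intro t ht
  rcases lt_or_ge t ρ with htρ | htρ
  · exact hy t ⟨ht.1, htρ⟩
  have ha : 0 < ρ / 2 := by positivity
  have haR : ρ / 2 < R := by linarith [ht.2]
  have hya : y (ρ / 2) = 0 := hy _ ⟨ha, by linarith⟩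
  have hga : g (ρ / 2) = 0 := by
    refine (h.deriv_fst _ ⟨ha, haR⟩).unique ?_
    refine (hasDerivAt_const (ρ / 2) (0 : ℝ)).congr_of_eventuallyEq ?_
    filter_upwards [Ioo_mem_nhds ha (by linarith : ρ / 2 < ρ)] with x hx using hy x hx
  have hder : ∀ x ∈ Icc (ρ / 2) t, HasDerivAt (fun x => (y x, g x))
      (g x, (μ / x ^ 2 - lam) * y x - g x / x) x := fun x hx =>
    have hx' : x ∈ Ioo 0 R := ⟨by linarith [hx.1], by linarith [hx.2, ht.2]⟩
    (h.deriv_fst x hx').prodMk (h.deriv_snd x hx')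
  -- Grönwall for the linear system (y, g). Starting at ρ/2 keeps the coefficients bounded; `K`
  -- dominates the system matrix on [ρ/2, t] in the sup norm.
  have key := eq_zero_of_abs_deriv_le_mul_abs_self_of_eq_zero_right
    (f := fun x => (y x, g x)) (a := ρ / 2) (b := t)
    (K := 1 + |μ| / (ρ / 2) ^ 2 + |lam| + 1 / (ρ / 2))
    (fun x hx => (hder x hx).continuousAt.continuousWithinAt)
    (fun x hx => (hder x ⟨hx.1, hx.2.le⟩).hasDerivWithinAt)
    (by simp [hya, hga]) ?_ t ⟨by linarith, le_rfl⟩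
  · simpa using congrArg Prod.fst key
  intro x hx
  have hx0 : 0 < x := lt_of_lt_of_le ha hx.1
  set N := ‖(y x, g x)‖
  have hyN : |y x| ≤ N := norm_fst_le (y x, g x)
  have hgN : |g x| ≤ N := norm_snd_le (y x, g x)
  have hN : 0 ≤ N := norm_nonneg _
  have h1 : |μ| / x ^ 2 ≤ |μ| / (ρ / 2) ^ 2 := by
    have := hx.1
    gcongr
  have h2 : 1 / x ≤ 1 / (ρ / 2) := one_div_le_one_div_of_le ha hx.1
  have h3 : 0 ≤ |μ| / (ρ / 2) ^ 2 := by positivity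
  have h4 : 0 ≤ 1 / (ρ / 2) := by positivity
  refine max_le ?_ ?_
  · change |g x| ≤ _
    nlinarith [mul_nonneg h3 hN, mul_nonneg h4 hN, mul_nonneg (abs_nonneg lam) hN]
  · change |(μ / x ^ 2 - lam) * y x - g x / x| ≤ _
    calc |(μ / x ^ 2 - lam) * y x - g x / x|
        ≤ |(μ / x ^ 2 - lam) * y x| + |g x / x| := abs_sub _ _
      _ ≤ (|μ| / x ^ 2 + |lam|) * |y x| + 1 / x * |g x| := by
          rw [abs_mul, abs_div, abs_of_pos hx0, div_mul_eq_mul_div, one_mul]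
          gcongr
          refine (abs_sub _ _).trans_eq ?_
          rw [abs_div, abs_of_nonneg (sq_nonneg x)]
      _ ≤ (|μ| / (ρ / 2) ^ 2 + |lam|) * N + 1 / (ρ / 2) * N := by gcongr
      _ ≤ _ := by nlinarith

/-- A differentiable function with zero derivative on `(R, ∞)` is constant there. -/
theorem exists_const_of_hasDerivAt_zero_Ioi {R : ℝ} {f : ℝ → ℝ}
    (hf : ∀ r ∈ Ioi R, HasDerivAt f 0 r) : ∃ c, ∀ r ∈ Ioi R, f r = c :=
  isOpen_Ioi.exists_is_const_of_deriv_eq_zero isPreconnected_Ioi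
    (fun r hr => (hf r hr).differentiableAt.differentiableWithinAt) (fun r hr => (hf r hr).deriv)

/-- A harmonic radial mode which is `O(r^{-1/2})` is `o(r^{-1/2})`. -/
theorem IsRadialMode.tendsto_sqrt_mul_of_bounded {R M : ℝ} (hR : 0 ≤ R) {n : ℕ} {y g : ℝ → ℝ}
    (h : IsRadialMode 0 ((n : ℝ) ^ 2) (Ioi R) y g)
    (hb : ∀ᶠ r in atTop, |√r * y r| ≤ M) :
    Tendsto (fun r => √r * y r) atTop (𝓝 0) := by
  have hinv : Tendsto (fun r : ℝ => (√r)⁻¹) atTop (𝓝 0) :=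
    tendsto_inv_atTop_zero.comp Real.tendsto_sqrt_atTop
  have hy0 : Tendsto y atTop (𝓝 0) := by
    refine squeeze_zero_norm' (a := fun r => M * (√r)⁻¹) ?_ (by simpa using hinv.const_mul M)
    filter_upwards [hb, eventually_gt_atTop 0] with r hr hr0
    have hs : 0 < √r := Real.sqrt_pos.2 hr0
    rw [abs_mul, abs_of_pos hs] at hr
    rw [Real.norm_eq_abs, ← div_eq_mul_inv, le_div_iff₀ hs]
    linarith
  rcases Nat.eq_zero_or_pos n with rfl | hn
  -- For n = 0 the equation is (r y')' = 0, so y = c log r + d, and y → 0 kills both constants.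
  · obtain ⟨c, hc⟩ : ∃ c, ∀ r ∈ Ioi R, r * g r = c := by
      refine exists_const_of_hasDerivAt_zero_Ioi fun r hr => ?_
      have hr0 : r ≠ 0 := (lt_of_le_of_lt hR hr).ne'
      refine ((hasDerivAt_id r).mul (h.deriv_snd r hr)).congr_deriv ?_
      simp only [id]; push_cast; field_simp; ring
    obtain ⟨d, hd⟩ : ∃ d, ∀ r ∈ Ioi R, y r - c * Real.log r = d := by
      refine exists_const_of_hasDerivAt_zero_Ioi fun r hr => ?_
      have hr0 : r ≠ 0 := (lt_of_le_of_lt hR hr).ne'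
      refine ((h.deriv_fst r hr).sub ((Real.hasDerivAt_log hr0).const_mul c)).congr_deriv ?_
      rw [← hc r hr]; field_simp; ring
    have hyd : ∀ᶠ r in atTop, y r = c * Real.log r + d := by
      filter_upwards [eventually_gt_atTop R] with r hr
      linarith [hd r hr]
    have hc0 : c = 0 := by
      by_contra hc0
      have h1 : Tendsto (fun r => (y r - d) / c) atTop (𝓝 ((0 - d) / c)) :=
        (hy0.sub_const d).div_const c
      refine not_tendsto_nhds_of_tendsto_atTop Real.tendsto_log_atTop _ (h1.congr' ?_)
      filter_upwards [hyd] with r hr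
      rw [hr]; field_simp; ring
    have hd0 : d = 0 := by
      have h1 : Tendsto y atTop (𝓝 d) := by
        refine tendsto_const_nhds.congr' ?_
        filter_upwards [hyd] with r hr
        simp [hr, hc0]
      exact tendsto_nhds_unique h1 hy0
    refine tendsto_const_nhds.congr' ?_
    filter_upwards [hyd] with r hr
    simp [hr, hc0, hd0]
  -- For y = a r^n + b r^{-n} this first integral is 2na; the next one is -2nb.
  obtain ⟨c, hc⟩ : ∃ c, ∀ r ∈ Ioi R, (r * g r + n * y r) / r ^ n = c := by
    refine exists_const_of_hasDerivAt_zero_Ioi fun r hr => ?_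
    have hr0 : r ≠ 0 := (lt_of_le_of_lt hR hr).ne'
    refine ((((hasDerivAt_id r).mul (h.deriv_snd r hr)).add
      ((h.deriv_fst r hr).const_mul (n : ℝ))).div (hasDerivAt_pow n r)
      (pow_ne_zero n hr0)).congr_deriv ?_
    have hp : r ^ n = r ^ (n - 1) * r := by rw [← pow_succ, Nat.sub_add_cancel hn]
    simp only [id, Pi.add_apply, Pi.mul_apply]
    rw [hp]; field_simp; ring
  obtain ⟨d, hd⟩ : ∃ d, ∀ r ∈ Ioi R, (r * g r - n * y r) * r ^ n = d := by
    refine exists_const_of_hasDerivAt_zero_Ioi fun r hr => ?_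
    have hr0 : r ≠ 0 := (lt_of_le_of_lt hR hr).ne'
    refine ((((hasDerivAt_id r).mul (h.deriv_snd r hr)).sub
      ((h.deriv_fst r hr).const_mul (n : ℝ))).mul (hasDerivAt_pow n r)).congr_deriv ?_
    have hp : r ^ n = r ^ (n - 1) * r := by rw [← pow_succ, Nat.sub_add_cancel hn]
    simp only [id, Pi.sub_apply, Pi.mul_apply]
    rw [hp]; field_simp; ring
  have hn' : (0 : ℝ) < n := by exact_mod_cast hn
  have hyr : ∀ r ∈ Ioi R, 2 * n * y r = c * r ^ n - d / r ^ n := by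
    intro r hr
    have hr0 : r ≠ 0 := (lt_of_le_of_lt hR hr).ne'
    rw [← hc r hr, ← hd r hr]; field_simp; ring
  have hdinv : Tendsto (fun r : ℝ => d / r ^ n) atTop (𝓝 0) :=
    tendsto_const_nhds.div_atTop (tendsto_pow_atTop hn.ne')
  have hc0 : c = 0 := by
    by_contra hc0
    have h1 : Tendsto (fun r => (2 * n * y r + d / r ^ n) / c) atTop
        (𝓝 ((2 * n * 0 + 0) / c)) := ((hy0.const_mul _).add hdinv).div_const c
    refine not_tendsto_nhds_of_tendsto_atTop (tendsto_pow_atTop (α := ℝ) hn.ne') _ (h1.congr' ?_)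
    filter_upwards [eventually_gt_atTop R] with r hr
    rw [hyr r hr, sub_add_cancel]; field_simp
  refine squeeze_zero_norm' (a := fun r => |d| / (2 * n) * (√r)⁻¹) ?_
    (by simpa using hinv.const_mul (|d| / (2 * n)))
  filter_upwards [eventually_gt_atTop R, eventually_ge_atTop 1] with r hr hr1
  have hs : 0 < √r := Real.sqrt_pos.2 (by linarith)
  have hss : √r * √r = r := Real.mul_self_sqrt (by linarith)
  have hle : r ≤ r ^ n := le_self_pow₀ hr1 hn.ne'
  have e : √r * y r = -(d / (2 * n) * (√r / r ^ n)) := by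
    have := hyr r hr
    rw [hc0, zero_mul, zero_sub] at this
    have : y r = -(d / r ^ n) / (2 * n) := by rw [eq_div_iff (by positivity)]; linarith
    rw [this]; field_simp
  rw [e, norm_neg, Real.norm_eq_abs, abs_mul, abs_div, abs_of_pos (by positivity : (0 : ℝ) < 2 * n),
    abs_of_nonneg (by positivity : 0 ≤ √r / r ^ n)]
  gcongr
  rw [div_le_iff₀ (by positivity), ← div_eq_inv_mul, le_div_iff₀ hs, hss]
  exact hle

/-- The Liouville substitution `v = √r y`: a radial mode becomes a solution of
`v'' = (c / r² - lam) v` with `c = μ - 1/4`. -/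
theorem IsRadialMode.liouville {lam μ R : ℝ} (hR : 0 ≤ R) {y g : ℝ → ℝ}
    (h : IsRadialMode lam μ (Ioi R) y g) :
    ∃ z : ℝ → ℝ, ∀ r ∈ Ioi R, HasDerivAt (fun r => √r * y r) (z r) r ∧
      HasDerivAt z (((μ - 1 / 4) / r ^ 2 - lam) * (√r * y r)) r := by
  refine ⟨fun r => √r * g r + y r / (2 * √r), fun r hr => ?_⟩
  have hr0 : 0 < r := lt_of_le_of_lt hR hr
  have hs : 0 < √r := Real.sqrt_pos.2 hr0
  have hss : r = √r ^ 2 := (Real.sq_sqrt hr0.le).symm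
  have hd := Real.hasDerivAt_sqrt hr0.ne'
  constructor
  · refine (hd.mul (h.deriv_fst r hr)).congr_deriv ?_
    field_simp; ring
  · refine ((hd.mul (h.deriv_snd r hr)).add ((h.deriv_fst r hr).div (hd.const_mul 2)
      (by positivity))).congr_deriv ?_
    -- With s = √r as the variable and s² for r, the identity is a rational one.
    have : ∀ s : ℝ, 0 < s → 1 / (2 * s) * g r + s * ((μ / (s ^ 2) ^ 2 - lam) * y r - g r / s ^ 2) +
        (g r * (2 * s) - y r * (2 * (1 / (2 * s)))) / (2 * s) ^ 2
        = ((μ - 1 / 4) / (s ^ 2) ^ 2 - lam) * (s * y r) := by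
      intro s hs
      field_simp; ring
    have := this _ hs
    rw [← hss] at this
    exact this

/-- Energy estimates for `v'' = (c / r² - k²) v` at infinity: the solution is bounded, and if it
tends to zero it vanishes identically. -/
theorem oscillator_energy {c k R : ℝ} (hR : 0 ≤ R) (hk : k ≠ 0) {v z : ℝ → ℝ}
    (hv : ∀ r ∈ Ioi R, HasDerivAt v (z r) r)
    (hz : ∀ r ∈ Ioi R, HasDerivAt z ((c / r ^ 2 - k ^ 2) * v r) r) :
    (∃ M, ∀ᶠ r in atTop, |v r| ≤ M ∧ |z r| ≤ M) ∧
      (Tendsto v atTop (𝓝 0) → ∀ r ∈ Ioi R, v r = 0) := by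
  -- The energy z² + k²v² has derivative (2c/r²) z v, and 2|k||z v| is at most the energy. So its
  -- logarithmic rate is at most C/r², and the factors e^{±C/r} make it monotone either way.
  set C := |c| / |k| with hC
  set En : ℝ → ℝ := fun r => z r ^ 2 + k ^ 2 * v r ^ 2 with hEn
  have hk2 : 0 < k ^ 2 := by positivity
  have hEnn : ∀ r, 0 ≤ En r := fun r => by positivity
  have hE : ∀ r ∈ Ioi R, HasDerivAt En (2 * c / r ^ 2 * (z r * v r)) r := fun r hr => by
    refine (((hz r hr).pow 2).add (((hv r hr).pow 2).const_mul (k ^ 2))).congr_deriv ?_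
    simp; ring
  have hbd : ∀ r ∈ Ioi R, |2 * c / r ^ 2 * (z r * v r)| ≤ C / r ^ 2 * En r := fun r hr => by
    have hr0 : 0 < r := lt_of_le_of_lt hR hr
    have hk' : 0 < |k| := abs_pos.2 hk
    have h1 : 2 * |k| * (|z r| * |v r|) ≤ En r := by
      have : En r = |z r| ^ 2 + |k| ^ 2 * |v r| ^ 2 := by simp [hEn]
      rw [this]
      nlinarith [sq_nonneg (|z r| - |k| * |v r|)]
    calc |2 * c / r ^ 2 * (z r * v r)| = C / r ^ 2 * (2 * |k| * (|z r| * |v r|)) := by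
          rw [abs_mul, abs_div, abs_mul, abs_mul, abs_of_pos (by positivity : (0 : ℝ) < r ^ 2), hC]
          simp; field_simp
      _ ≤ C / r ^ 2 * En r := by gcongr
  have hexp : ∀ a r : ℝ, r ∈ Ioi R →
      HasDerivAt (fun r => Real.exp (a / r)) (Real.exp (a / r) * (-(a / r ^ 2))) r := by
    intro a r hr
    have hr0 : r ≠ 0 := (lt_of_le_of_lt hR hr).ne'
    refine ((hasDerivAt_const r a).div (hasDerivAt_id r) hr0).exp.congr_deriv ?_
    simp; ring
  have hcont : ∀ a, ∀ r ∈ Ioi R, HasDerivAt (fun r => En r * Real.exp (a / r))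
      (Real.exp (a / r) * (2 * c / r ^ 2 * (z r * v r) - a / r ^ 2 * En r)) r := fun a r hr => by
    refine ((hE r hr).mul (hexp a r hr)).congr_deriv ?_
    ring
  have hanti : AntitoneOn (fun r => En r * Real.exp (C / r)) (Ioi R) := by
    refine antitoneOn_of_deriv_nonpos (convex_Ioi R)
      (fun r hr => (hcont C r hr).continuousAt.continuousWithinAt) ?_ ?_
    · rw [interior_Ioi]
      exact fun r hr => (hcont C r hr).differentiableAt.differentiableWithinAt
    · rw [interior_Ioi]
      intro r hr
      rw [(hcont C r hr).deriv]
      have := (abs_le.1 (hbd r hr)).2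
      exact mul_nonpos_of_nonneg_of_nonpos (Real.exp_nonneg _) (by linarith)
  have hmono : MonotoneOn (fun r => En r * Real.exp (-C / r)) (Ioi R) := by
    refine monotoneOn_of_deriv_nonneg (convex_Ioi R)
      (fun r hr => (hcont (-C) r hr).continuousAt.continuousWithinAt) ?_ ?_
    · rw [interior_Ioi]
      exact fun r hr => (hcont (-C) r hr).differentiableAt.differentiableWithinAt
    · rw [interior_Ioi]
      intro r hr
      rw [(hcont (-C) r hr).deriv]
      have := (abs_le.1 (hbd r hr)).1
      refine mul_nonneg (Real.exp_nonneg _) ?_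
      rw [neg_div, neg_mul]; linarith
  have hC0 : 0 ≤ C := by positivity
  have hbounded : ∃ M, ∀ᶠ r in atTop, |v r| ≤ M ∧ |z r| ≤ M := by
    set B := En (R + 1) * Real.exp (C / (R + 1))
    have hB : 0 ≤ B := mul_nonneg (hEnn _) (Real.exp_nonneg _)
    refine ⟨√(B / k ^ 2) + √B, ?_⟩
    filter_upwards [eventually_ge_atTop (R + 1)] with r hr
    have hrR : r ∈ Ioi R := by simp only [mem_Ioi]; linarith
    have hr0 : 0 < r := lt_of_le_of_lt hR hrR
    have h1 : En r ≤ B := by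
      refine le_trans ?_ (hanti (by simp : R + 1 ∈ Ioi R) hrR hr)
      exact le_mul_of_one_le_right (hEnn r) (Real.one_le_exp (by positivity))
    have h2 : v r ^ 2 ≤ B / k ^ 2 := by
      rw [le_div_iff₀ hk2]; simp only [hEn] at h1; nlinarith [sq_nonneg (z r)]
    have h3 : z r ^ 2 ≤ B := by
      simp only [hEn] at h1; nlinarith [mul_nonneg hk2.le (sq_nonneg (v r))]
    have h4 := Real.sqrt_nonneg (B / k ^ 2)
    have h5 := Real.sqrt_nonneg B
    exact ⟨(Real.abs_le_sqrt h2).trans (by linarith), (Real.abs_le_sqrt h3).trans (by linarith)⟩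
  refine ⟨hbounded, fun hv0 r₀ hr₀ => ?_⟩
  by_contra hne
  obtain ⟨M, hM⟩ := hbounded
  have hr₀0 : 0 < r₀ := lt_of_le_of_lt hR hr₀
  -- A solution that is nonzero at r₀ keeps energy at least δ from there on.
  set δ := En r₀ * Real.exp (-C / r₀)
  have hδ : 0 < δ := mul_pos (by have : 0 < v r₀ ^ 2 := by positivity
                                 simp only [hEn]; positivity) (Real.exp_pos _)
  have hEδ : ∀ r, r₀ ≤ r → δ ≤ En r := fun r hr => by
    have hrR : r ∈ Ioi R := lt_of_lt_of_le hr₀ hr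
    refine (hmono hr₀ hrR hr).trans ?_
    refine mul_le_of_le_one_right (hEnn r) (Real.exp_le_one_iff.2 ?_)
    exact div_nonpos_of_nonpos_of_nonneg (by linarith) (by linarith)
  have hsmall : ∀ᶠ r in atTop, (2 * k ^ 2 + |c|) * v r ^ 2 < δ / 2 := by
    have : Tendsto (fun r => (2 * k ^ 2 + |c|) * v r ^ 2) atTop (𝓝 ((2 * k ^ 2 + |c|) * 0 ^ 2)) :=
      (hv0.pow 2).const_mul _
    exact this.eventually_lt_const (by simpa using hδ)
  obtain ⟨a, ha⟩ := eventually_atTop.1 (hsmall.and (hM.and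
    ((eventually_gt_atTop R).and ((eventually_ge_atTop r₀).and (eventually_ge_atTop 1)))))
  -- Virial argument: (v z)' equals the energy minus multiples of v², so it stays above δ/2 once v
  -- is small, although v z is bounded by M².
  have hD : ∀ r, a ≤ r → HasDerivAt (fun r => v r * z r)
      (z r * z r + v r * ((c / r ^ 2 - k ^ 2) * v r)) r := fun r hr =>
    (hv r (ha r hr).2.2.1).mul (hz r (ha r hr).2.2.1)
  have hDle : ∀ r, a ≤ r → δ / 2 ≤ z r * z r + v r * ((c / r ^ 2 - k ^ 2) * v r) := fun r hr => by
    obtain ⟨h1, -, h2, h3, h4⟩ := ha r hr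
    have h5 := hEδ r h3
    have h6 : -|c| ≤ c / r ^ 2 := by
      refine (abs_le.1 ?_).1
      rw [abs_div, abs_of_pos (by positivity : (0 : ℝ) < r ^ 2)]
      exact div_le_self (abs_nonneg c) (one_le_pow₀ h4)
    simp only [hEn] at h5
    nlinarith [mul_le_mul_of_nonneg_right h6 (sq_nonneg (v r))]
  have hM0 : 0 ≤ M := (abs_nonneg _).trans (ha a le_rfl).2.1.1
  -- Over this length v z grows by at least 2M² + 1, more than its bound permits.
  set T := (2 * M ^ 2 + 1) / (δ / 2)
  have hT : 0 < T := by positivity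
  have hmv := (convex_Ici a).mul_sub_le_image_sub_of_le_deriv (f := fun r => v r * z r)
    (C := δ / 2) (fun r hr => (hD r hr).continuousAt.continuousWithinAt)
    (by rw [interior_Ici]
        exact fun r hr => (hD r (le_of_lt hr)).differentiableAt.differentiableWithinAt)
    (by rw [interior_Ici]; intro r hr; rw [(hD r (le_of_lt hr)).deriv]; exact hDle r (le_of_lt hr))
    a self_mem_Ici (a + T) (by simp [hT.le]) (by linarith)
  have hT' : δ / 2 * (a + T - a) = 2 * M ^ 2 + 1 := by
    simp only [T]; field_simp; ring
  have hb : ∀ r, a ≤ r → |v r * z r| ≤ M ^ 2 := fun r hr => by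
    rw [abs_mul, sq]
    exact mul_le_mul (ha r hr).2.1.1 (ha r hr).2.1.2 (abs_nonneg _) hM0
  have h1 := (abs_le.1 (hb a le_rfl)).1
  have h2 := (abs_le.1 (hb (a + T) (by linarith))).2
  rw [hT'] at hmv
  linarith

/-- If the sum of a Helmholtz mode and a harmonic mode is `o(r^{-1/2})`, then the Helmholtz mode
vanishes. -/
theorem IsRadialMode.eq_zero_of_tendsto_add {k R : ℝ} (hR : 0 ≤ R) (hk : k ≠ 0) {n : ℕ}
    {y g y₀ g₀ : ℝ → ℝ} (h : IsRadialMode (k ^ 2) ((n : ℝ) ^ 2) (Ioi R) y g)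
    (h₀ : IsRadialMode 0 ((n : ℝ) ^ 2) (Ioi R) y₀ g₀)
    (hlim : Tendsto (fun r => √r * (y r + y₀ r)) atTop (𝓝 0)) : ∀ r ∈ Ioi R, y r = 0 := by
  obtain ⟨z, hz⟩ := h.liouville hR
  obtain ⟨⟨M, hM⟩, hzero⟩ := oscillator_energy hR hk (fun r hr => (hz r hr).1)
    (fun r hr => (hz r hr).2)
  have hb : ∀ᶠ r in atTop, |√r * y₀ r| ≤ M + 1 := by
    filter_upwards [hM, hlim.abs.eventually_le_const (by simp : |(0 : ℝ)| < 1)] with r h1 h2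
    have e : √r * y₀ r = √r * (y r + y₀ r) - √r * y r := by ring
    rw [e]
    exact (abs_sub _ _).trans (by linarith [h1.1])
  have h0 := h₀.tendsto_sqrt_mul_of_bounded hR hb
  have hv : Tendsto (fun r => √r * y r) atTop (𝓝 0) := by
    have := hlim.sub h0
    rw [sub_zero] at this
    exact this.congr fun r => by ring
  intro r hr
  have hs : √r ≠ 0 := (Real.sqrt_pos.2 (lt_of_le_of_lt hR hr)).ne'
  exact (mul_eq_zero.1 (hzero hv r hr)).resolve_left hs

/-! ### Polar frames and the Laplacian -/

/-- The unit vector with polar angle `θ`. -/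
noncomputable def radialDir (θ : ℝ) : Plane := !₂[Real.cos θ, Real.sin θ]

/-- The unit tangent vector of the unit circle at the polar angle `θ`. -/
noncomputable def angularDir (θ : ℝ) : Plane := !₂[-Real.sin θ, Real.cos θ]

theorem radialDir_eq (θ : ℝ) : radialDir θ =
    Real.cos θ • EuclideanSpace.single 0 (1 : ℝ) + Real.sin θ • EuclideanSpace.single 1 (1 : ℝ) := by
  ext i; fin_cases i <;> simp [radialDir]

theorem angularDir_eq (θ : ℝ) : angularDir θ =
    -Real.sin θ • EuclideanSpace.single 0 (1 : ℝ) + Real.cos θ • EuclideanSpace.single 1 (1 : ℝ) := by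
  ext i; fin_cases i <;> simp [angularDir]

theorem hasDerivAt_radialDir (θ : ℝ) : HasDerivAt radialDir (angularDir θ) θ := by
  rw [funext radialDir_eq, angularDir_eq]
  exact ((Real.hasDerivAt_cos θ).smul_const _).add ((Real.hasDerivAt_sin θ).smul_const _)

theorem hasDerivAt_angularDir (θ : ℝ) : HasDerivAt angularDir (-radialDir θ) θ := by
  rw [funext angularDir_eq, radialDir_eq, neg_add, ← neg_smul, ← neg_smul]
  exact ((Real.hasDerivAt_sin θ).neg.smul_const _).add ((Real.hasDerivAt_cos θ).smul_const _)

theorem continuous_radialDir : Continuous radialDir :=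
  continuous_iff_continuousAt.2 fun θ => (hasDerivAt_radialDir θ).continuousAt

theorem radialDir_periodic : Function.Periodic radialDir (2 * Real.pi) := fun θ => by
  simp [radialDir]

theorem angularDir_periodic : Function.Periodic angularDir (2 * Real.pi) := fun θ => by
  simp [angularDir]

theorem norm_radialDir (θ : ℝ) : ‖radialDir θ‖ = 1 := by
  simp [radialDir, EuclideanSpace.norm_eq, Fin.sum_univ_two]

theorem exists_eq_add_norm_smul_radialDir (c x : Plane) : ∃ θ, x = c + ‖x - c‖ • radialDir θ := by
  set z : ℂ := ⟨(x - c) 0, (x - c) 1⟩ with hz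
  have hn : ‖z‖ = ‖x - c‖ := by
    rw [EuclideanSpace.norm_eq, Complex.norm_eq_sqrt_sq_add_sq]
    simp [hz, Fin.sum_univ_two]
  refine ⟨z.arg, ?_⟩
  have h0 := Complex.norm_mul_cos_arg z
  have h1 := Complex.norm_mul_sin_arg z
  rw [hn] at h0 h1
  rw [← sub_eq_iff_eq_add']
  ext i; fin_cases i
  · simpa [radialDir, hz] using h0.symm
  · simpa [radialDir, hz] using h1.symm

theorem laplacian_eq_fderiv_fderiv (f : Plane → ℂ) (x : Plane) :
    Laplacian.laplacian f x =
      fderiv ℝ (fderiv ℝ f) x (EuclideanSpace.single 0 1) (EuclideanSpace.single 0 1) +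
      fderiv ℝ (fderiv ℝ f) x (EuclideanSpace.single 1 1) (EuclideanSpace.single 1 1) := by
  rw [InnerProductSpace.laplacian_eq_iteratedFDeriv_orthonormalBasis f
    (EuclideanSpace.basisFun (Fin 2) ℝ)]
  simp [iteratedFDeriv_two_apply, Fin.sum_univ_two]

/-- The trace of a bilinear form is the same in every orthonormal basis. The mixed terms cancel
without symmetry of the Hessian, so no smoothness is needed. -/
theorem laplacian_eq_radial_add_angular (f : Plane → ℂ) (x : Plane) (θ : ℝ) :
    Laplacian.laplacian f x =
      fderiv ℝ (fderiv ℝ f) x (radialDir θ) (radialDir θ) +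
      fderiv ℝ (fderiv ℝ f) x (angularDir θ) (angularDir θ) := by
  rw [laplacian_eq_fderiv_fderiv, radialDir_eq, angularDir_eq]
  simp only [map_add, map_smul, add_apply, smul_apply,
    Complex.real_smul]
  have : (Real.sin θ : ℂ) ^ 2 = 1 - (Real.cos θ : ℂ) ^ 2 := by
    rw [eq_sub_iff_add_eq]; exact_mod_cast Real.sin_sq_add_cos_sq θ
  push_cast at this ⊢
  ring_nf
  rw [this]
  ring

/-! ### Angular Fourier modes and their radial equation -/

/-- Differentiation under the integral sign over a compact interval. -/
theorem hasDerivAt_intervalIntegral_of_continuousOn {a b : ℝ} {s : Set ℝ} (hs : IsOpen s)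
    {F F' : ℝ → ℝ → ℂ} (hF : ∀ r ∈ s, Continuous (F r))
    (hF' : ContinuousOn (fun q : ℝ × ℝ => F' q.1 q.2) (s ×ˢ univ))
    (hd : ∀ r ∈ s, ∀ θ, HasDerivAt (fun r => F r θ) (F' r θ) r) :
    ∀ r ∈ s, HasDerivAt (fun r => ∫ θ in a..b, F r θ) (∫ θ in a..b, F' r θ) r := by
  intro r hr
  obtain ⟨ε, hε, hball⟩ := Metric.nhds_basis_closedBall.mem_iff.1 (hs.mem_nhds hr)
  have hF'c : ∀ r ∈ s, Continuous (F' r) := fun r hr =>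
    hF'.comp_continuous (f := fun θ => (r, θ)) (by fun_prop) fun θ => ⟨hr, mem_univ _⟩
  obtain ⟨C, hC⟩ := ((isCompact_closedBall r ε).prod
    (isCompact_uIcc (a := a) (b := b))).exists_bound_of_continuousOn
    (hF'.mono (prod_mono hball (subset_univ _)))
  refine (intervalIntegral.hasDerivAt_integral_of_dominated_loc_of_deriv_le
    (bound := fun _ => C) (Metric.closedBall_mem_nhds r hε) ?_ ((hF r hr).intervalIntegrable _ _)
    (hF'c r hr).aestronglyMeasurable ?_ intervalIntegrable_const ?_).2
  · filter_upwards [hs.mem_nhds hr] with x hx using (hF x hx).aestronglyMeasurable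
  · exact Eventually.of_forall fun t ht x hx => hC (x, t) ⟨hx, uIoc_subset_uIcc ht⟩
  · exact Eventually.of_forall fun t _ x hx => hd x (hball hx) t

/-- The character `θ ↦ e^{-inθ}`. -/
noncomputable def angularChar (n : ℤ) (θ : ℝ) : ℂ := Complex.exp (-(n * Complex.I) * θ)

theorem hasDerivAt_angularChar (n : ℤ) (θ : ℝ) :
    HasDerivAt (angularChar n) (-(n * Complex.I) * angularChar n θ) θ := by
  have h : HasDerivAt (fun θ : ℝ => -(n * Complex.I) * (θ : ℂ)) (-(n * Complex.I) * 1) θ :=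
    (Complex.ofRealCLM.hasDerivAt (x := θ)).const_mul _
  refine h.cexp.congr_deriv ?_
  rw [angularChar]; ring

theorem continuous_angularChar (n : ℤ) : Continuous (angularChar n) :=
  continuous_iff_continuousAt.2 fun θ => (hasDerivAt_angularChar n θ).continuousAt

theorem angularChar_zero (n : ℤ) : angularChar n 0 = 1 := by simp [angularChar]

theorem angularChar_two_pi (n : ℤ) : angularChar n (2 * Real.pi) = 1 := by
  rw [angularChar, Complex.exp_eq_one_iff]
  exact ⟨-n, by push_cast; ring⟩

theorem norm_angularChar (n : ℤ) (θ : ℝ) : ‖angularChar n θ‖ = 1 := by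
  have : -(n * Complex.I) * θ = ((-n * θ : ℝ) : ℂ) * Complex.I := by push_cast; ring
  rw [angularChar, this, Complex.norm_exp_ofReal_mul_I]

/-- The `n`-th angular Fourier coefficient (up to the factor `2π`) of `f` on the circle of radius
`r` about `c`. -/
noncomputable def angularMode (c : Plane) (n : ℤ) (f : Plane → ℂ) (r : ℝ) : ℂ :=
  ∫ θ in (0 : ℝ)..2 * Real.pi, angularChar n θ * f (c + r • radialDir θ)

/-- The angular part of the polar Laplacian, integrated by parts against `e^{-inθ}`. -/
theorem integral_polar_laplacian_eq_zero {lam : ℝ} {f : Plane → ℂ} {D : Plane → Plane →L[ℝ] ℂ}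
    {D2 : Plane → Plane →L[ℝ] Plane →L[ℝ] ℂ} (c : Plane) (n : ℤ) (r : ℝ)
    (hD : ∀ θ, HasFDerivAt f (D (c + r • radialDir θ)) (c + r • radialDir θ))
    (hD2 : ∀ θ, HasFDerivAt D (D2 (c + r • radialDir θ)) (c + r • radialDir θ))
    (heq : ∀ θ, D2 (c + r • radialDir θ) (radialDir θ) (radialDir θ) +
      D2 (c + r • radialDir θ) (angularDir θ) (angularDir θ) + lam * f (c + r • radialDir θ) = 0)
    (c1 : Continuous fun θ => angularChar n θ * f (c + r • radialDir θ))
    (c2 : Continuous fun θ => angularChar n θ * D (c + r • radialDir θ) (radialDir θ))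
    (c3 : Continuous fun θ => angularChar n θ *
      D2 (c + r • radialDir θ) (radialDir θ) (radialDir θ)) :
    ((n : ℂ) ^ 2 - r ^ 2 * lam) *
        (∫ θ in (0 : ℝ)..2 * Real.pi, angularChar n θ * f (c + r • radialDir θ)) -
      r * (∫ θ in (0 : ℝ)..2 * Real.pi,
        angularChar n θ * D (c + r • radialDir θ) (radialDir θ)) -
      r ^ 2 * (∫ θ in (0 : ℝ)..2 * Real.pi,
        angularChar n θ * D2 (c + r • radialDir θ) (radialDir θ) (radialDir θ)) = 0 := by
  have hPθ : ∀ θ, HasDerivAt (fun θ => c + r • radialDir θ) (r • angularDir θ) θ := fun θ =>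
    ((hasDerivAt_radialDir θ).const_smul r).const_add c
  -- With χ = e^{-inθ}, the function is W = f_θ χ - f χ', so W' = χ (f_θθ + n² f). Here f_θθ = r²
  -- D2(τ, τ) - r D(ν) for the tangent τ and the normal ν, and the equation eliminates D2(τ, τ).
  -- Periodicity of W then makes the integral vanish.
  have hWd : ∀ θ, HasDerivAt (fun θ => D (c + r • radialDir θ) (r • angularDir θ) *
        angularChar n θ + (n * Complex.I) * (f (c + r • radialDir θ) * angularChar n θ))
      (((n : ℂ) ^ 2 - r ^ 2 * lam) * (angularChar n θ * f (c + r • radialDir θ)) -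
        r * (angularChar n θ * D (c + r • radialDir θ) (radialDir θ)) -
        r ^ 2 * (angularChar n θ *
          D2 (c + r • radialDir θ) (radialDir θ) (radialDir θ))) θ := by
    intro θ
    have h1 : HasDerivAt (fun θ => D (c + r • radialDir θ)) _ θ :=
      (hD2 θ).comp_hasDerivAt θ (hPθ θ)
    have h1' := h1.clm_apply ((hasDerivAt_angularDir θ).const_smul r)
    have h2 : HasDerivAt (fun θ => f (c + r • radialDir θ)) _ θ :=
      (hD θ).comp_hasDerivAt θ (hPθ θ)
    refine ((h1'.mul (hasDerivAt_angularChar n θ)).add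
      ((h2.mul (hasDerivAt_angularChar n θ)).const_mul (n * Complex.I))).congr_deriv ?_
    have hL := heq θ
    simp only [map_smul, smul_apply, Complex.real_smul, map_neg, smul_neg, Pi.smul_apply]
    linear_combination (-(n : ℂ) ^ 2 * f (c + r • radialDir θ) * angularChar n θ) * Complex.I_sq +
      r ^ 2 * angularChar n θ * hL
  have hint := intervalIntegral.integral_eq_sub_of_hasDerivAt (a := 0) (b := 2 * Real.pi)
    (fun θ _ => hWd θ) (Continuous.intervalIntegrable
      (((continuous_const.mul c1).sub (continuous_const.mul c2)).sub (continuous_const.mul c3)) _ _)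
  have e1 := radialDir_periodic 0
  have e2 := angularDir_periodic 0
  rw [zero_add] at e1 e2
  rw [e1, e2, angularChar_zero, angularChar_two_pi, sub_self, intervalIntegral.integral_sub,
    intervalIntegral.integral_sub, intervalIntegral.integral_const_mul,
    intervalIntegral.integral_const_mul, intervalIntegral.integral_const_mul] at hint
  · exact hint
  · exact (continuous_const.mul c1).intervalIntegrable _ _
  · exact (continuous_const.mul c2).intervalIntegrable _ _
  · exact ((continuous_const.mul c1).sub (continuous_const.mul c2)).intervalIntegrable _ _
  · exact (continuous_const.mul c3).intervalIntegrable _ _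

/-- Two differentiations under the integral express y' and y'' through radial derivatives;
`integral_polar_laplacian_eq_zero` is then the radial equation multiplied by -r². -/
theorem hasDerivAt_angularMode_of_hasFDerivAt {lam : ℝ} {E : Set Plane} {f : Plane → ℂ}
    {D : Plane → Plane →L[ℝ] ℂ} {D2 : Plane → Plane →L[ℝ] Plane →L[ℝ] ℂ}
    (hD : ∀ x ∈ E, HasFDerivAt f (D x) x) (hD2 : ∀ x ∈ E, HasFDerivAt D (D2 x) x)
    (hD2c : ContinuousOn D2 E)
    (heq : ∀ x ∈ E, ∀ θ, D2 x (radialDir θ) (radialDir θ) + D2 x (angularDir θ) (angularDir θ) +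
      lam * f x = 0) (c : Plane) (n : ℤ) {s : Set ℝ} (hs : IsOpen s) (hs0 : s ⊆ Ioi 0)
    (hsE : ∀ r ∈ s, ∀ θ, c + r • radialDir θ ∈ E) :
    ∃ g : ℝ → ℂ, ∀ r ∈ s, HasDerivAt (angularMode c n f) (g r) r ∧
      HasDerivAt g ((((n : ℝ) ^ 2 / r ^ 2 - lam : ℝ) : ℂ) * angularMode c n f r - g r / r) r := by
  have hPc : Continuous fun q : ℝ × ℝ => c + q.1 • radialDir q.2 :=
    continuous_const.add (continuous_fst.smul (continuous_radialDir.comp continuous_snd))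
  have hPmaps : MapsTo (fun q : ℝ × ℝ => c + q.1 • radialDir q.2) (s ×ˢ univ) E :=
    fun q hq => hsE _ hq.1 _
  have hrc : Continuous fun q : ℝ × ℝ => radialDir q.2 := continuous_radialDir.comp continuous_snd
  have hac : Continuous fun q : ℝ × ℝ => angularChar n q.2 :=
    (continuous_angularChar n).comp continuous_snd
  have hcf : ContinuousOn f E := fun x hx => (hD x hx).continuousAt.continuousWithinAt
  have hcD : ContinuousOn D E := fun x hx => (hD2 x hx).continuousAt.continuousWithinAt
  have hfc : ContinuousOn (fun q : ℝ × ℝ => angularChar n q.2 * f (c + q.1 • radialDir q.2))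
      (s ×ˢ univ) := hac.continuousOn.mul (hcf.comp hPc.continuousOn hPmaps)
  have hDc : ContinuousOn (fun q : ℝ × ℝ => angularChar n q.2 *
      D (c + q.1 • radialDir q.2) (radialDir q.2)) (s ×ˢ univ) :=
    hac.continuousOn.mul ((hcD.comp hPc.continuousOn hPmaps).clm_apply hrc.continuousOn)
  have hD2c' : ContinuousOn (fun q : ℝ × ℝ => angularChar n q.2 *
      D2 (c + q.1 • radialDir q.2) (radialDir q.2) (radialDir q.2)) (s ×ˢ univ) :=
    hac.continuousOn.mul (((hD2c.comp hPc.continuousOn hPmaps).clm_apply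
      hrc.continuousOn).clm_apply hrc.continuousOn)
  have slice : ∀ {G : ℝ × ℝ → ℂ}, ContinuousOn G (s ×ˢ univ) → ∀ r ∈ s,
      Continuous fun θ => G (r, θ) := fun hG r hr =>
    hG.comp_continuous (by fun_prop) fun θ => ⟨hr, mem_univ _⟩
  have hPr : ∀ r θ, HasDerivAt (fun r => c + r • radialDir θ) (radialDir θ) r := fun r θ => by
    have h : HasDerivAt (fun r : ℝ => r) 1 r := hasDerivAt_id r
    simpa using (h.smul_const (radialDir θ)).const_add c
  have hy : ∀ r ∈ s, HasDerivAt (angularMode c n f) (∫ θ in (0 : ℝ)..2 * Real.pi,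
      angularChar n θ * D (c + r • radialDir θ) (radialDir θ)) r :=
    hasDerivAt_intervalIntegral_of_continuousOn hs (slice hfc) hDc fun r hr θ =>
      ((hD _ (hsE r hr θ)).comp_hasDerivAt r (hPr r θ)).const_mul (angularChar n θ)
  have hg : ∀ r ∈ s, HasDerivAt (fun r => ∫ θ in (0 : ℝ)..2 * Real.pi,
      angularChar n θ * D (c + r • radialDir θ) (radialDir θ)) (∫ θ in (0 : ℝ)..2 * Real.pi,
      angularChar n θ * D2 (c + r • radialDir θ) (radialDir θ) (radialDir θ)) r :=
    hasDerivAt_intervalIntegral_of_continuousOn hs (slice hDc) hD2c' fun r hr θ => by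
      have h1 : HasDerivAt (fun r => D (c + r • radialDir θ)) _ r :=
        (hD2 _ (hsE r hr θ)).comp_hasDerivAt r (hPr r θ)
      have h2 := h1.clm_apply (hasDerivAt_const r (radialDir θ))
      simpa using h2.const_mul (angularChar n θ)
  refine ⟨_, fun r hr => ⟨hy r hr, (hg r hr).congr_deriv ?_⟩⟩
  have hr0 : (r : ℂ) ≠ 0 := Complex.ofReal_ne_zero.2 (hs0 hr).ne'
  have key := integral_polar_laplacian_eq_zero (lam := lam) c n r (fun θ => hD _ (hsE r hr θ))
    (fun θ => hD2 _ (hsE r hr θ)) (fun θ => heq _ (hsE r hr θ) θ)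
    (slice hfc r hr) (slice hDc r hr) (slice hD2c' r hr)
  rw [angularMode]
  push_cast
  field_simp
  linear_combination -key

/-- The angular modes of a solution of `Δf + lam f = 0` are radial modes. -/
theorem isRadialMode_angularMode {lam : ℝ} {E : Set Plane} (hE : IsOpen E) {f : Plane → ℂ}
    (hf : ContDiffOn ℝ 2 f E)
    (heq : ∀ x ∈ E, Laplacian.laplacian f x + lam * f x = 0) (c : Plane) (n : ℤ)
    {s : Set ℝ} (hs : IsOpen s) (hs0 : s ⊆ Ioi 0) (hsE : ∀ r ∈ s, ∀ θ, c + r • radialDir θ ∈ E) :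
    ∃ g : ℝ → ℂ,
      IsRadialMode lam ((n.natAbs : ℝ) ^ 2) s (fun r => (angularMode c n f r).re)
        (fun r => (g r).re) ∧
      IsRadialMode lam ((n.natAbs : ℝ) ^ 2) s (fun r => (angularMode c n f r).im)
        (fun r => (g r).im) := by
  have hf1 : ContDiffOn ℝ 1 (fderiv ℝ f) E := hf.fderiv_of_isOpen hE (by norm_num)
  obtain ⟨g, hg⟩ := hasDerivAt_angularMode_of_hasFDerivAt (lam := lam) (E := E) (f := f)
    (D := fderiv ℝ f) (D2 := fderiv ℝ (fderiv ℝ f))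
    (fun x hx => ((hf.differentiableOn (by norm_num)).differentiableAt
      (hE.mem_nhds hx)).hasFDerivAt)
    (fun x hx => ((hf1.differentiableOn (by norm_num)).differentiableAt
      (hE.mem_nhds hx)).hasFDerivAt)
    (hf1.continuousOn_fderiv_of_isOpen hE le_rfl)
    (fun x hx θ => by rw [← laplacian_eq_radial_add_angular]; exact heq x hx) c n hs hs0 hsE
  -- Only n² enters the equation; the natural number |n| is what the powers r^n require.
  have hn2 : ((n.natAbs : ℝ) ^ 2) = (n : ℝ) ^ 2 := by
    rw [Nat.cast_natAbs, Int.cast_abs, sq_abs]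
  refine ⟨g, ⟨fun r hr => ?_, fun r hr => ?_⟩, ⟨fun r hr => ?_, fun r hr => ?_⟩⟩
  · exact Complex.reCLM.hasFDerivAt.comp_hasDerivAt r (hg r hr).1
  · refine (Complex.reCLM.hasFDerivAt.comp_hasDerivAt r (hg r hr).2).congr_deriv ?_
    rw [hn2, Complex.reCLM_apply, Complex.sub_re, Complex.re_ofReal_mul, Complex.div_ofReal_re]
  · exact Complex.imCLM.hasFDerivAt.comp_hasDerivAt r (hg r hr).1
  · refine (Complex.imCLM.hasFDerivAt.comp_hasDerivAt r (hg r hr).2).congr_deriv ?_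
    rw [hn2, Complex.imCLM_apply, Complex.sub_im, Complex.im_ofReal_mul, Complex.div_ofReal_im]

/-! ### Completeness and decay of angular modes -/

/-- A continuous periodic function all of whose Fourier coefficients vanish is zero. -/
theorem eq_zero_of_forall_integral_angularChar_eq_zero {f : ℝ → ℂ} (hf : Continuous f)
    (hper : Function.Periodic f (2 * Real.pi))
    (h : ∀ n : ℤ, ∫ θ in (0 : ℝ)..2 * Real.pi, angularChar n θ * f θ = 0) (θ : ℝ) : f θ = 0 := by
  have : Fact (0 < 2 * Real.pi) := ⟨Real.two_pi_pos⟩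
  set F : C(AddCircle (2 * Real.pi), ℂ) := ⟨AddCircle.liftIco (2 * Real.pi) 0 f,
    AddCircle.liftIco_continuous (by simpa using (hper 0).symm) hf.continuousOn⟩
  have hcoef : ∀ n, fourierCoeff F n = 0 := by
    intro n
    change fourierCoeff (AddCircle.liftIco (2 * Real.pi) 0 f) n = 0
    rw [fourierCoeff_liftIco_eq, fourierCoeffOn_eq_integral, zero_add, sub_zero]
    have : ∀ x : ℝ, fourier (-n) (x : AddCircle (2 * Real.pi)) • f x = angularChar n x * f x := by
      intro x
      rw [fourier_coe_apply, smul_eq_mul, angularChar]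
      congr 2
      have := Real.pi_ne_zero
      push_cast
      field_simp
    simp only [this, h n, smul_zero]
  -- Vanishing coefficients are trivially summable, so the Fourier series converges to F, and its
  -- sum is 0.
  have hsum := hasSum_fourier_series_of_summable (f := F) (by rw [funext hcoef]; exact summable_zero)
  have hF : F = 0 := by
    refine hsum.unique ?_
    simp [hcoef, hasSum_zero]
  obtain ⟨t, ht, hft⟩ := hper.exists_mem_Ico₀ Real.two_pi_pos θ
  rw [hft, ← AddCircle.liftIco_coe_apply (p := 2 * Real.pi) (a := 0) (f := f)
    (by simpa using ht)]
  exact DFunLike.congr_fun hF _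

theorem eq_zero_of_forall_angularMode_eq_zero {E : Set Plane} {f : Plane → ℂ}
    (hf : ContinuousOn f E) {c : Plane} {r : ℝ} (hE : ∀ θ, c + r • radialDir θ ∈ E)
    (h : ∀ n, angularMode c n f r = 0) (θ : ℝ) : f (c + r • radialDir θ) = 0 := by
  refine eq_zero_of_forall_integral_angularChar_eq_zero (f := fun θ => f (c + r • radialDir θ))
    (hf.comp_continuous (continuous_const.add (continuous_radialDir.const_smul r)) hE) ?_ h θ
  intro t
  simp only [radialDir_periodic t]

/-- The angular modes of `f` about the origin are `o(r^{-1/2})` if the arc length integral of `‖u‖²`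
tends to zero and `f` is a component of `u`. -/
theorem tendsto_sqrt_mul_norm_angularMode {R : ℝ} {E : Set Plane}
    {u : Plane → EuclideanSpace ℂ (Fin 2)} (hu : ContinuousOn u E)
    (hRE : ∀ r > R, ∀ θ, r • radialDir θ ∈ E)
    (hdecay : Tendsto (fun r : ℝ => circleArcIntegral (fun y => ‖u y‖ ^ 2) r) atTop (𝓝 0))
    (j : Fin 2) (n : ℤ) :
    Tendsto (fun r => √r * ‖angularMode 0 n (fun x => u x j) r‖) atTop (𝓝 0) := by
  -- Young's inequality √r|u| ≤ r|u|²/(2ε) + ε/2, integrated over the angle, stands in for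
  -- Cauchy–Schwarz.
  have hbound : ∀ ε > 0, ∀ r > max R 0, √r * ‖angularMode 0 n (fun x => u x j) r‖ ≤
      circleArcIntegral (fun y => ‖u y‖ ^ 2) r / (2 * ε) + Real.pi * ε := by
    intro ε hε r hr
    have hr0 : 0 < r := lt_of_le_of_lt (le_max_right _ _) hr
    have hc : Continuous fun θ => u (r • radialDir θ) :=
      hu.comp_continuous (continuous_radialDir.const_smul r)
        (hRE r (lt_of_le_of_lt (le_max_left _ _) hr))
    have hcj : Continuous fun θ => u (r • radialDir θ) j :=
      (EuclideanSpace.proj (𝕜 := ℂ) j).continuous.comp hc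
    have hpt : ∀ θ, r • radialDir θ = !₂[r * Real.cos θ, r * Real.sin θ] := fun θ => by
      ext i; fin_cases i <;> simp [radialDir]
    have hs : √r * √r = r := Real.mul_self_sqrt hr0.le
    have hA : Continuous fun θ => ‖u (r • radialDir θ)‖ ^ 2 * r := (hc.norm.pow 2).mul_const r
    calc √r * ‖angularMode 0 n (fun x => u x j) r‖
        ≤ √r * ∫ θ in (0 : ℝ)..2 * Real.pi, ‖u (r • radialDir θ) j‖ := by
          gcongr
          refine (intervalIntegral.norm_integral_le_integral_norm Real.two_pi_pos.le).trans_eq ?_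
          simp [norm_angularChar]
      _ = ∫ θ in (0 : ℝ)..2 * Real.pi, √r * ‖u (r • radialDir θ) j‖ := by
          rw [intervalIntegral.integral_const_mul]
      _ ≤ ∫ θ in (0 : ℝ)..2 * Real.pi, (‖u (r • radialDir θ)‖ ^ 2 * r / (2 * ε) + ε / 2) := by
          refine intervalIntegral.integral_mono_on Real.two_pi_pos.le
            ((hcj.norm.const_mul _).intervalIntegrable _ _)
            (((hA.div_const _).add continuous_const).intervalIntegrable _ _) fun θ _ => ?_
          have h1 : ‖u (r • radialDir θ) j‖ ≤ ‖u (r • radialDir θ)‖ := PiLp.norm_apply_le _ j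
          have h2 : √r * ‖u (r • radialDir θ) j‖ ≤ √r * ‖u (r • radialDir θ)‖ := by gcongr
          refine h2.trans ?_
          set a := ‖u (r • radialDir θ)‖
          rw [div_add_div _ _ (by positivity) (by norm_num), le_div_iff₀ (by positivity)]
          nlinarith [sq_nonneg (√r * a - ε)]
      _ = circleArcIntegral (fun y => ‖u y‖ ^ 2) r / (2 * ε) + Real.pi * ε := by
          rw [intervalIntegral.integral_add ((hA.div_const _).intervalIntegrable _ _)
            intervalIntegrable_const, intervalIntegral.integral_div, circleArcIntegral]
          simp only [hpt, intervalIntegral.integral_const, smul_eq_mul]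
          ring
  rw [Metric.tendsto_nhds]
  intro δ hδ
  set ε := δ / (4 * Real.pi)
  have hε : 0 < ε := by positivity
  have hπε : Real.pi * ε = δ / 4 := by simp only [ε]; field_simp
  filter_upwards [eventually_gt_atTop (max R 0),
    hdecay.eventually_lt_const (by positivity : 0 < δ / 2 * (2 * ε))] with r hr hI
  have h1 := hbound ε hε r hr
  have h2 := (div_lt_iff₀ (by positivity : 0 < 2 * ε)).2 hI
  rw [Real.dist_eq, sub_zero, abs_of_nonneg (by positivity)]
  linarith

/-! ### Partial derivatives and the Cauchy–Riemann equations -/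

/-- Evaluation at the orthonormal basis determines linear maps on the plane. -/
theorem plane_clm_apply (L : Plane →L[ℝ] ℂ) (v : Plane) :
    L v = v 0 * L (EuclideanSpace.single 0 1) + v 1 * L (EuclideanSpace.single 1 1) := by
  have : v = v 0 • EuclideanSpace.single 0 (1 : ℝ) + v 1 • EuclideanSpace.single 1 (1 : ℝ) := by
    ext i; fin_cases i <;> simp
  conv_lhs => rw [this]
  simp

theorem partialDeriv_partialDeriv {E : Set Plane} (hE : IsOpen E) {f : Plane → ℂ}
    (hf : ContDiffOn ℝ 2 f E) (i j : Fin 2) {x : Plane} (hx : x ∈ E) :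
    partialDeriv i (partialDeriv j f) x =
      fderiv ℝ (fderiv ℝ f) x (EuclideanSpace.single i 1) (EuclideanSpace.single j 1) := by
  have hf1 : ContDiffOn ℝ 1 (fderiv ℝ f) E := hf.fderiv_of_isOpen hE (by norm_num)
  have h := ((hf1.differentiableOn (by norm_num)).differentiableAt (hE.mem_nhds hx)).hasFDerivAt
  have h' := (h.clm_apply (hasFDerivAt_const (EuclideanSpace.single j (1 : ℝ) : Plane) x)).fderiv
  change fderiv ℝ (fun y => fderiv ℝ f y (EuclideanSpace.single j 1)) x _ = _
  rw [h']
  simp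

theorem laplacian_eq_partialDeriv {E : Set Plane} (hE : IsOpen E) {f : Plane → ℂ}
    (hf : ContDiffOn ℝ 2 f E) {x : Plane} (hx : x ∈ E) : Laplacian.laplacian f x =
      partialDeriv 0 (partialDeriv 0 f) x + partialDeriv 1 (partialDeriv 1 f) x := by
  rw [partialDeriv_partialDeriv hE hf _ _ hx, partialDeriv_partialDeriv hE hf _ _ hx,
    laplacian_eq_fderiv_fderiv]

theorem partialDeriv_congr {f g : Plane → ℂ} {x : Plane} (h : f =ᶠ[𝓝 x] g) (j : Fin 2) :
    partialDeriv j f x = partialDeriv j g x := by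
  rw [partialDeriv, partialDeriv, h.fderiv_eq]

theorem partialDeriv_const_mul {f : Plane → ℂ} {x : Plane} (hf : DifferentiableAt ℝ f x) (a : ℂ)
    (j : Fin 2) : partialDeriv j (fun y => a * f y) x = a * partialDeriv j f x := by
  rw [partialDeriv, fderiv_const_mul hf a]
  rfl

/-- The linear identification of the plane with `ℂ`. -/
noncomputable def planeToComplex : Plane ≃L[ℝ] ℂ :=
  Complex.orthonormalBasisOneI.repr.symm.toContinuousLinearEquiv

theorem planeToComplex_single_zero : planeToComplex (EuclideanSpace.single 0 1) = 1 := by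
  simp [planeToComplex]

theorem planeToComplex_single_one : planeToComplex (EuclideanSpace.single 1 1) = Complex.I := by
  simp [planeToComplex]

theorem hasFDerivAt_comp_planeToComplex {F : ℂ → ℂ} {F' : ℂ} {x : Plane}
    (hF : HasDerivAt F F' (planeToComplex x)) :
    HasFDerivAt (fun y => F (planeToComplex y))
      ((planeToComplex : Plane →L[ℝ] ℂ).smulRight F') x := by
  have := hF.complexToReal_fderiv.comp x planeToComplex.hasFDerivAt
  refine this.congr_fderiv ?_
  ext v
  simp [mul_comm]

theorem partialDeriv_comp_planeToComplex {F : ℂ → ℂ} {x : Plane}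
    (hF : DifferentiableAt ℂ F (planeToComplex x)) :
    partialDeriv 0 (fun y => F (planeToComplex y)) x = deriv F (planeToComplex x) ∧
      partialDeriv 1 (fun y => F (planeToComplex y)) x =
        Complex.I * deriv F (planeToComplex x) := by
  have h := (hasFDerivAt_comp_planeToComplex hF.hasDerivAt).fderiv
  constructor
  · rw [partialDeriv, h]; simp [planeToComplex_single_zero]
  · rw [partialDeriv, h]; simp [planeToComplex_single_one]

/-- On holomorphic functions ∂₁ acts as i∂₀, so the Laplacian is (1 + i²)F'' = 0. -/
theorem harmonicAt_comp_planeToComplex {F : ℂ → ℂ} {x : Plane}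
    (hF : AnalyticAt ℂ F (planeToComplex x)) :
    InnerProductSpace.HarmonicAt (fun y => F (planeToComplex y)) x := by
  set V := {y : Plane | AnalyticAt ℂ F (planeToComplex y)}
  have hV : IsOpen V := (isOpen_analyticAt ℂ F).preimage planeToComplex.continuous
  have hcd : ContDiffOn ℝ 2 (fun y => F (planeToComplex y)) V := fun y hy =>
    (((AnalyticAt.contDiffAt (n := 2) hy).restrict_scalars ℝ).comp y
      planeToComplex.contDiff.contDiffAt).contDiffWithinAt
  refine ⟨hcd.contDiffAt (hV.mem_nhds hF), ?_⟩
  filter_upwards [hV.mem_nhds hF] with y hy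
  have hy' : AnalyticAt ℂ (deriv F) (planeToComplex y) := AnalyticAt.deriv hy
  have h0 : partialDeriv 0 (fun y => F (planeToComplex y)) =ᶠ[𝓝 y] fun z =>
      deriv F (planeToComplex z) := by
    filter_upwards [hV.mem_nhds hy] with z hz
    exact (partialDeriv_comp_planeToComplex (AnalyticAt.differentiableAt hz)).1
  have h1 : partialDeriv 1 (fun y => F (planeToComplex y)) =ᶠ[𝓝 y] fun z =>
      Complex.I * deriv F (planeToComplex z) := by
    filter_upwards [hV.mem_nhds hy] with z hz
    exact (partialDeriv_comp_planeToComplex (AnalyticAt.differentiableAt hz)).2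
  rw [laplacian_eq_partialDeriv hV hcd hy, partialDeriv_congr h0, partialDeriv_congr h1,
    partialDeriv_const_mul
      (hasFDerivAt_comp_planeToComplex hy'.differentiableAt.hasDerivAt).differentiableAt,
    (partialDeriv_comp_planeToComplex hy'.differentiableAt).1,
    (partialDeriv_comp_planeToComplex hy'.differentiableAt).2, Pi.zero_apply]
  linear_combination (deriv (deriv F) (planeToComplex y)) * Complex.I_sq

/-- A function satisfying the Cauchy–Riemann equations on an open subset of the plane is
holomorphic in the complex coordinate. -/
theorem exists_analyticAt_of_cauchyRiemann {B : Set Plane} (hB : IsOpen B) {f : Plane → ℂ}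
    (hf : DifferentiableOn ℝ f B)
    (hCR : ∀ x ∈ B, partialDeriv 1 f x = Complex.I * partialDeriv 0 f x) :
    ∃ F : ℂ → ℂ, (∀ x, f x = F (planeToComplex x)) ∧
      ∀ x ∈ B, AnalyticAt ℂ F (planeToComplex x) := by
  refine ⟨fun z => f (planeToComplex.symm z), fun x => by simp, fun x hx => ?_⟩
  have hB' : IsOpen (planeToComplex.symm ⁻¹' B) := hB.preimage planeToComplex.symm.continuous
  refine DifferentiableOn.analyticAt (s := planeToComplex.symm ⁻¹' B) (fun z hz => ?_)
    (hB'.mem_nhds (by simpa using hx))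
  refine DifferentiableAt.differentiableWithinAt ?_
  have hfz := (hf.differentiableAt (hB.mem_nhds hz))
  refine differentiableAt_complex_iff_differentiableAt_real.2
    ⟨hfz.comp z planeToComplex.symm.differentiableAt, ?_⟩
  have hd := (hfz.hasFDerivAt.comp z planeToComplex.symm.hasFDerivAt).fderiv
  change fderiv ℝ (f ∘ planeToComplex.symm) z Complex.I =
    Complex.I • fderiv ℝ (f ∘ planeToComplex.symm) z 1
  rw [hd]
  have := hCR _ hz
  simp only [partialDeriv] at this
  simpa [← planeToComplex_single_zero, ← planeToComplex_single_one] using this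

/-- If `p` and `q` satisfy `∂₀ q = ∂₁ p` and `∂₁ q = -∂₀ p`, the partial derivatives of `p` are
harmonic. -/
theorem harmonicAt_partialDeriv_of_conjugate {B : Set Plane} (hB : IsOpen B) {p q : Plane → ℂ}
    (hp : DifferentiableOn ℝ p B) (hq : DifferentiableOn ℝ q B)
    (h0 : ∀ x ∈ B, partialDeriv 0 q x = partialDeriv 1 p x)
    (h1 : ∀ x ∈ B, partialDeriv 1 q x = -partialDeriv 0 p x) (j : Fin 2) :
    ∀ x ∈ B, InnerProductSpace.HarmonicAt (partialDeriv j p) x := by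
  have hpB : ∀ x ∈ B, DifferentiableAt ℝ p x := fun x hx => hp.differentiableAt (hB.mem_nhds hx)
  have hqB : ∀ x ∈ B, DifferentiableAt ℝ q x := fun x hx => hq.differentiableAt (hB.mem_nhds hx)
  set conj : ℂ →L[ℝ] ℂ := (Complex.conjCLE : ℂ →L[ℝ] ℂ) with hconj
  have hconj_apply : ∀ z, conj z = (starRingEnd ℂ) z := fun z => rfl
  have hpd1 : ∀ i, ∀ x ∈ B, partialDeriv i (fun y => p y - Complex.I * q y) x =
      partialDeriv i p x - Complex.I * partialDeriv i q x := fun i x hx => by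
    have := ((hpB x hx).hasFDerivAt.sub ((hqB x hx).hasFDerivAt.const_mul Complex.I)).fderiv
    simp only [partialDeriv]
    erw [this]
    simp
  have hpd2 : ∀ i, ∀ x ∈ B, partialDeriv i (fun y => conj (p y + Complex.I * q y)) x =
      conj (partialDeriv i p x + Complex.I * partialDeriv i q x) := fun i x hx => by
    have := (conj.hasFDerivAt.comp x
      ((hpB x hx).hasFDerivAt.add ((hqB x hx).hasFDerivAt.const_mul Complex.I))).fderiv
    simp only [partialDeriv]
    erw [this]
    simp
  -- As p and q are complex-valued, p - iq alone does not determine p. The combination p + iq is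
  -- antiholomorphic, hence the conjugate in the second application.
  obtain ⟨F, hF, hFa⟩ := exists_analyticAt_of_cauchyRiemann hB
    (f := fun y => p y - Complex.I * q y) (fun x hx =>
      ((hpB x hx).sub ((hqB x hx).const_mul _)).differentiableWithinAt) (fun x hx => by
      rw [hpd1 1 x hx, hpd1 0 x hx, h0 x hx, h1 x hx]
      linear_combination (partialDeriv 1 p x) * Complex.I_sq)
  obtain ⟨G, hG, hGa⟩ := exists_analyticAt_of_cauchyRiemann hB
    (f := fun y => conj (p y + Complex.I * q y)) (fun x hx =>
      (conj.differentiableAt.comp x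
        ((hpB x hx).add ((hqB x hx).const_mul _))).differentiableWithinAt) (fun x hx => by
      rw [hpd2 1 x hx, hpd2 0 x hx, h0 x hx, h1 x hx]
      simp only [hconj_apply, map_add, map_mul, map_neg, Complex.conj_I]
      linear_combination ((starRingEnd ℂ) (partialDeriv 1 p x)) * Complex.I_sq)
  have hF' : ∀ x ∈ B, deriv F (planeToComplex x) =
      partialDeriv 0 p x - Complex.I * partialDeriv 1 p x := fun x hx => by
    rw [← (partialDeriv_comp_planeToComplex (hFa x hx).differentiableAt).1, ← funext hF,
      hpd1 0 x hx, h0 x hx]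
  have hG' : ∀ x ∈ B, conj (deriv G (planeToComplex x)) =
      partialDeriv 0 p x + Complex.I * partialDeriv 1 p x := fun x hx => by
    rw [← (partialDeriv_comp_planeToComplex (hGa x hx).differentiableAt).1, ← funext hG,
      hpd2 0 x hx, h0 x hx]
    simp [hconj_apply]
  have hFh : ∀ x ∈ B, InnerProductSpace.HarmonicAt (fun y => deriv F (planeToComplex y)) x :=
    fun x hx => harmonicAt_comp_planeToComplex (hFa x hx).deriv
  have hGh : ∀ x ∈ B, InnerProductSpace.HarmonicAt
      (fun y => conj (deriv G (planeToComplex y))) x :=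
    fun x hx => (harmonicAt_comp_planeToComplex (hGa x hx).deriv).comp_CLM conj
  have hsmul : ∀ (a : ℂ) {h : Plane → ℂ} {x : Plane}, InnerProductSpace.HarmonicAt h x →
      InnerProductSpace.HarmonicAt (fun y => a * h y) x := fun a h x hh =>
    hh.comp_CLM (ContinuousLinearMap.mul ℝ ℂ a)
  intro x hx
  -- ∂₀p = (F' + conj G')/2 and ∂₁p = i(F' - conj G')/2.
  fin_cases j
  · refine (InnerProductSpace.harmonicAt_congr_nhds ?_).1
      ((hsmul (1 / 2) (hFh x hx)).add (hsmul (1 / 2) (hGh x hx)))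
    filter_upwards [hB.mem_nhds hx] with y hy
    simp only [Pi.add_apply, hF' y hy, hG' y hy, Fin.zero_eta]
    ring
  · refine (InnerProductSpace.harmonicAt_congr_nhds ?_).1
      ((hsmul (Complex.I / 2) (hFh x hx)).add (hsmul (-Complex.I / 2) (hGh x hx)))
    filter_upwards [hB.mem_nhds hx] with y hy
    simp only [Pi.add_apply, hF' y hy, hG' y hy, Fin.mk_one]
    linear_combination (-partialDeriv 1 p y) * Complex.I_sq

/-! ### Stream functions and harmonicity of the pressure gradient -/

/-- A divergence-free field on a convex open set has a stream function. -/
theorem exists_streamFunction {B : Set Plane} (hB : IsOpen B) (hBc : Convex ℝ B)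
    {a b : Plane → ℂ} (ha : DifferentiableOn ℝ a B) (hb : DifferentiableOn ℝ b B)
    (hdiv : ∀ x ∈ B, partialDeriv 0 a x + partialDeriv 1 b x = 0) :
    ∃ ψ : Plane → ℂ, DifferentiableOn ℝ ψ B ∧
      ∀ x ∈ B, partialDeriv 0 ψ x = b x ∧ partialDeriv 1 ψ x = -a x := by
  set e0 : Plane →L[ℝ] ℝ := EuclideanSpace.proj 0
  set e1 : Plane →L[ℝ] ℝ := EuclideanSpace.proj 1
  set L0 := ContinuousLinearMap.smulRightL ℝ Plane ℂ e0
  set L1 := ContinuousLinearMap.smulRightL ℝ Plane ℂ e1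
  have hd : ∀ x ∈ B, HasFDerivAt (fun y => L0 (b y) - L1 (a y))
      (L0 ∘L fderiv ℝ b x - L1 ∘L fderiv ℝ a x) x := fun x hx =>
    (L0.hasFDerivAt.comp x (hb.differentiableAt (hB.mem_nhds hx)).hasFDerivAt).sub
      (L1.hasFDerivAt.comp x (ha.differentiableAt (hB.mem_nhds hx)).hasFDerivAt)
  -- Poincaré lemma for b dx₀ - a dx₁, which is closed exactly because the divergence vanishes.
  obtain ⟨ψ, hψ⟩ := hBc.exists_forall_hasFDerivAt_of_fderiv_symmetric hB
    (ω := fun y => L0 (b y) - L1 (a y))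
    (fun x hx => (hd x hx).differentiableAt.differentiableWithinAt) (fun x hx v w => by
      rw [(hd x hx).fderiv]
      have := hdiv x hx
      simp only [partialDeriv] at this
      change w 0 • fderiv ℝ b x v - w 1 • fderiv ℝ a x v =
        v 0 • fderiv ℝ b x w - v 1 • fderiv ℝ a x w
      rw [plane_clm_apply _ v, plane_clm_apply _ w, plane_clm_apply (fderiv ℝ a x) v,
        plane_clm_apply (fderiv ℝ a x) w]
      simp only [Complex.real_smul]
      linear_combination (w 0 * v 1 - v 0 * w 1 : ℂ) * this)
  refine ⟨ψ, fun x hx => (hψ x hx).differentiableAt.differentiableWithinAt, fun x hx => ?_⟩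
  simp only [partialDeriv, (hψ x hx).fderiv]
  simp [L0, L1, e0, e1]

theorem differentiableOn_partialDeriv {E : Set Plane} (hE : IsOpen E) {f : Plane → ℂ}
    (hf : ContDiffOn ℝ 2 f E) (j : Fin 2) : DifferentiableOn ℝ (partialDeriv j f) E := by
  have hf1 : ContDiffOn ℝ 1 (fderiv ℝ f) E := hf.fderiv_of_isOpen hE (by norm_num)
  exact (hf1.differentiableOn (by norm_num)).clm_apply (differentiableOn_const _)

theorem IsOscillatoryStokes.contDiffOn_component {k : ℂ} {E : Set Plane}
    {u : Plane → EuclideanSpace ℂ (Fin 2)} {p : Plane → ℂ} (h : IsOscillatoryStokes k E u p)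
    (j : Fin 2) : ContDiffOn ℝ 2 (fun x => u x j) E :=
  ((EuclideanSpace.proj (𝕜 := ℂ) j).restrictScalars ℝ).contDiff.comp_contDiffOn
    h.contDiffOn_velocity

/-- The pressure gradient of a classical solution of the oscillatory Stokes equations is
harmonic. -/
theorem IsOscillatoryStokes.harmonicOnNhd_partialDeriv_pressure {k : ℂ} {E : Set Plane}
    (hE : IsOpen E) {u : Plane → EuclideanSpace ℂ (Fin 2)} {p : Plane → ℂ}
    (h : IsOscillatoryStokes k E u p) (j : Fin 2) :
    InnerProductSpace.HarmonicOnNhd (partialDeriv j p) E := by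
  intro x₀ hx₀
  obtain ⟨ε, hε, hball⟩ := Metric.isOpen_iff.1 hE x₀ hx₀
  set B := Metric.ball x₀ ε
  have hB : IsOpen B := Metric.isOpen_ball
  have hu0 := (h.contDiffOn_component 0).mono hball
  have hu1 := (h.contDiffOn_component 1).mono hball
  have hdiv : ∀ x ∈ B, partialDeriv 0 (fun y => u y 0) x + partialDeriv 1 (fun y => u y 1) x = 0 :=
    fun x hx => by simpa [Fin.sum_univ_two] using h.divergence_free x (hball hx)
  obtain ⟨ψ, hψd, hψ⟩ := exists_streamFunction hB (convex_ball _ _)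
    (hu0.differentiableOn (by norm_num)) (hu1.differentiableOn (by norm_num)) hdiv
  have hd1 := differentiableOn_partialDeriv hB hu1 0
  have hd0 := differentiableOn_partialDeriv hB hu0 1
  -- The conjugate of p is q = vorticity + k²ψ. It needs only first derivatives of u, and the
  -- momentum equation becomes the conjugacy relations between p and q.
  have hq : ∀ i, ∀ x ∈ B, HasFDerivAt (fun y => partialDeriv 0 (fun y => u y 1) y -
      partialDeriv 1 (fun y => u y 0) y + k ^ 2 * ψ y)
      (fderiv ℝ (partialDeriv 0 (fun y => u y 1)) x - fderiv ℝ (partialDeriv 1 (fun y => u y 0)) x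
        + k ^ 2 • fderiv ℝ ψ x) x ∧
      partialDeriv i (fun y => partialDeriv 0 (fun y => u y 1) y -
        partialDeriv 1 (fun y => u y 0) y + k ^ 2 * ψ y) x =
      partialDeriv i (partialDeriv 0 (fun y => u y 1)) x -
        partialDeriv i (partialDeriv 1 (fun y => u y 0)) x + k ^ 2 * partialDeriv i ψ x := by
    intro i x hx
    have := (((hd1.differentiableAt (hB.mem_nhds hx)).hasFDerivAt.sub
      (hd0.differentiableAt (hB.mem_nhds hx)).hasFDerivAt).add
      ((hψd.differentiableAt (hB.mem_nhds hx)).hasFDerivAt.const_mul (k ^ 2)))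
    refine ⟨this, ?_⟩
    have h2 := this.fderiv
    simp only [partialDeriv] at h2 ⊢
    erw [h2]
    simp
  have hdiv' : ∀ i, ∀ x ∈ B, partialDeriv i (partialDeriv 0 (fun y => u y 0)) x =
      -partialDeriv i (partialDeriv 1 (fun y => u y 1)) x := by
    intro i x hx
    have : partialDeriv 0 (fun y => u y 0) =ᶠ[𝓝 x] fun y => -partialDeriv 1 (fun y => u y 1) y := by
      filter_upwards [hB.mem_nhds hx] with y hy using eq_neg_of_add_eq_zero_left (hdiv y hy)
    simp only [partialDeriv] at this ⊢
    rw [this.fderiv_eq, fderiv_fun_neg]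
    rfl
  have hsymm : ∀ {f : Plane → ℂ}, ContDiffOn ℝ 2 f B → ∀ x ∈ B,
      partialDeriv 0 (partialDeriv 1 f) x = partialDeriv 1 (partialDeriv 0 f) x := by
    intro f hf x hx
    rw [partialDeriv_partialDeriv hB hf _ _ hx, partialDeriv_partialDeriv hB hf _ _ hx]
    exact ((hf.contDiffAt (hB.mem_nhds hx)).isSymmSndFDerivAt (by simp)) _ _
  refine harmonicAt_partialDeriv_of_conjugate hB
    ((h.contDiffOn_pressure.mono hball).differentiableOn (by norm_num))
    (fun x hx => (hq 0 x hx).1.differentiableAt.differentiableWithinAt)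
    (fun x hx => ?_) (fun x hx => ?_) j x₀ (Metric.mem_ball_self hε)
  · rw [(hq 0 x hx).2, (hψ x hx).1, ← h.momentum x (hball hx) 1, laplacian_eq_partialDeriv hB hu1 hx, hsymm hu0 x hx,
      hdiv' 1 x hx]
    ring
  · rw [(hq 1 x hx).2, (hψ x hx).2, ← h.momentum x (hball hx) 0, laplacian_eq_partialDeriv hB hu0 hx, hdiv' 0 x hx,
      hsymm hu1 x hx]
    ring

/-! ### Helmholtz functions: unique continuation and decay at infinity -/

/-- `f` is a `C²` solution of `Δf + lam f = 0` in `E`. -/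
structure IsHelmholtz (lam : ℝ) (E : Set Plane) (f : Plane → ℂ) : Prop where
  contDiffOn : ContDiffOn ℝ 2 f E
  laplacian_add : ∀ x ∈ E, Laplacian.laplacian f x + lam * f x = 0

/-- Each angular mode about c vanishes for small radii, hence up to R by uniqueness for the radial
equation; completeness of the modes finishes. -/
theorem IsHelmholtz.eq_zero_on_ball {lam : ℝ} {E : Set Plane} (hE : IsOpen E) {f : Plane → ℂ}
    (hf : IsHelmholtz lam E f) {c : Plane} {ρ R : ℝ} (hR : Metric.ball c R ⊆ E) (hρ : 0 < ρ)
    (h0 : ∀ x ∈ Metric.ball c ρ, f x = 0) : ∀ x ∈ Metric.ball c R, f x = 0 := by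
  intro x hx
  rcases eq_or_ne x c with rfl | hxc
  · exact h0 _ (Metric.mem_ball_self hρ)
  have hmem : ∀ t : ℝ, ∀ r ∈ Ioo 0 t, ∀ θ, c + r • radialDir θ ∈ Metric.ball c t :=
    fun t r hr θ => by
      rw [Metric.mem_ball, dist_self_add_left, norm_smul, norm_radialDir, mul_one,
        Real.norm_of_nonneg hr.1.le]
      exact hr.2
  have hsE : ∀ r ∈ Ioo 0 R, ∀ θ, c + r • radialDir θ ∈ E := fun r hr θ => hR (hmem R r hr θ)
  have hx' : ‖x - c‖ ∈ Ioo 0 R :=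
    ⟨norm_pos_iff.2 (sub_ne_zero.2 hxc), by rwa [← dist_eq_norm]⟩
  have hmode : ∀ n, angularMode c n f ‖x - c‖ = 0 := by
    intro n
    have hnear : ∀ r ∈ Ioo 0 ρ, angularMode c n f r = 0 := fun r hr => by
      simp [angularMode, h0 _ (hmem ρ r hr _)]
    obtain ⟨g, hre, him⟩ := isRadialMode_angularMode hE hf.contDiffOn hf.laplacian_add c n
      isOpen_Ioo (fun r hr => hr.1) hsE
    exact Complex.ext
      (hre.eq_zero_of_eq_zero_near hρ (fun r hr => by rw [hnear r hr, Complex.zero_re]) _ hx')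
      (him.eq_zero_of_eq_zero_near hρ (fun r hr => by rw [hnear r hr, Complex.zero_im]) _ hx')
  obtain ⟨θ, hθ⟩ := exists_eq_add_norm_smul_radialDir c x
  rw [hθ]
  exact eq_zero_of_forall_angularMode_eq_zero hf.contDiffOn.continuousOn (hsE _ hx') hmode θ

/-- Unique continuation for the Helmholtz equation. -/
theorem IsHelmholtz.eq_zero_of_eventually {lam : ℝ} {E : Set Plane} (hE : IsOpen E)
    (hEc : IsPreconnected E) {f : Plane → ℂ} (hf : IsHelmholtz lam E f) {x₀ : Plane}
    (hx₀ : x₀ ∈ E) (h0 : ∀ᶠ x in 𝓝 x₀, f x = 0) : ∀ x ∈ E, f x = 0 := by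
  have hsub : E ⊆ {x | ∀ᶠ y in 𝓝 x, f y = 0} := by
    refine hEc.subset_of_closure_inter_subset isOpen_setOfPred_eventually_nhds ⟨x₀, hx₀, h0⟩ ?_
    rintro x ⟨hxcl, hxE⟩
    obtain ⟨ε, hε, hball⟩ := Metric.isOpen_iff.1 hE x hxE
    -- With y within ε/2 of x, the ball of radius ε/2 about y contains x and still lies in E.
    obtain ⟨y, hy, hxy⟩ := Metric.mem_closure_iff.1 hxcl (ε / 2) (by positivity)
    obtain ⟨ρ, hρ, hyρ⟩ := Metric.eventually_nhds_iff_ball.1 hy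
    have hyE : Metric.ball y (ε / 2) ⊆ E := by
      refine (Metric.ball_subset_ball' ?_).trans hball
      rw [dist_comm]; linarith
    have hz := hf.eq_zero_on_ball hE hyE hρ hyρ
    filter_upwards [Metric.isOpen_ball.mem_nhds (Metric.mem_ball.2 hxy)] with z hz' using hz z hz'
  exact fun x hx => (hsub hx).self_of_nhds

/-- If the sum of a Helmholtz and a harmonic function outside a disc has `o(r^{-1/2})` angular
modes, then the Helmholtz function vanishes there. -/
theorem IsHelmholtz.eq_zero_of_tendsto_angularMode_add {k R : ℝ} (hR : 0 ≤ R) (hk : k ≠ 0)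
    {E : Set Plane} (hE : IsOpen E) (hRE : ∀ r > R, ∀ θ, (0 : Plane) + r • radialDir θ ∈ E)
    {w h : Plane → ℂ} (hw : IsHelmholtz (k ^ 2) E w) (hh : IsHelmholtz 0 E h)
    (hlim : ∀ n, Tendsto (fun r => √r * ‖angularMode 0 n w r + angularMode 0 n h r‖) atTop (𝓝 0)) :
    ∀ x : Plane, R < ‖x‖ → w x = 0 := by
  intro x hx
  have hmode : ∀ n, ∀ r ∈ Ioi R, angularMode 0 n w r = 0 := by
    intro n
    obtain ⟨g, hre, him⟩ := isRadialMode_angularMode hE hw.contDiffOn hw.laplacian_add 0 n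
      isOpen_Ioi (Ioi_subset_Ioi hR) hRE
    obtain ⟨g₀, hre₀, him₀⟩ := isRadialMode_angularMode hE hh.contDiffOn hh.laplacian_add 0 n
      isOpen_Ioi (Ioi_subset_Ioi hR) hRE
    intro r hr
    refine Complex.ext (hre.eq_zero_of_tendsto_add hR hk hre₀ ?_ r hr)
      (him.eq_zero_of_tendsto_add hR hk him₀ ?_ r hr)
    · refine squeeze_zero_norm (fun r => ?_) (hlim n)
      rw [norm_mul, Real.norm_of_nonneg (Real.sqrt_nonneg r), ← Complex.add_re]
      gcongr
      exact Complex.abs_re_le_norm _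
    · refine squeeze_zero_norm (fun r => ?_) (hlim n)
      rw [norm_mul, Real.norm_of_nonneg (Real.sqrt_nonneg r), ← Complex.add_im]
      gcongr
      exact Complex.abs_im_le_norm _
  obtain ⟨θ, hθ⟩ := exists_eq_add_norm_smul_radialDir 0 x
  rw [sub_zero] at hθ
  rw [hθ]
  exact eq_zero_of_forall_angularMode_eq_zero hw.contDiffOn.continuousOn (hRE _ hx)
    (fun n => hmode n _ hx) θ

theorem angularMode_add {E : Set Plane} {f g : Plane → ℂ} (hf : ContinuousOn f E)
    (hg : ContinuousOn g E) {c : Plane} {r : ℝ} (hE : ∀ θ, c + r • radialDir θ ∈ E) (n : ℤ) :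
    angularMode c n (fun x => f x + g x) r = angularMode c n f r + angularMode c n g r := by
  have hP : Continuous fun θ => c + r • radialDir θ :=
    continuous_const.add (continuous_radialDir.const_smul r)
  simp only [angularMode, mul_add]
  exact intervalIntegral.integral_add
    (((continuous_angularChar n).mul (hf.comp_continuous hP hE)).intervalIntegrable _ _)
    (((continuous_angularChar n).mul (hg.comp_continuous hP hE)).intervalIntegrable _ _)

/-! ### The exterior domain and the conclusion -/

/-- The exterior of finitely many bounded sets contains the complement of a disc. -/
theorem exists_forall_norm_gt_mem_exteriorOf {m : ℕ} {Ω : Fin m → Set Plane}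
    (hΩ : ∀ i, Bornology.IsBounded (Ω i)) : ∃ R, 0 ≤ R ∧ ∀ x, R < ‖x‖ → x ∈ exteriorOf Ω := by
  obtain ⟨R, hR⟩ := (Bornology.isBounded_iUnion.2 hΩ).closure.exists_norm_le
  exact ⟨max R 0, le_max_right _ _, fun x hx hmem =>
    absurd (hR x hmem) (not_le.2 (lt_of_le_of_lt (le_max_left _ _) hx))⟩

theorem mainTheorem8 (m : ℕ) (Ω : Fin m → Set Plane)
    (hΩ_open : ∀ i, IsOpen (Ω i)) (hΩ_conn : ∀ i, IsConnected (Ω i))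
    (hΩ_bdd : ∀ i, Bornology.IsBounded (Ω i))
    (E : Set Plane) (hE : E = exteriorOf Ω) (hE_conn : IsConnected E)
    (k : ℝ) (hk : k ≠ 0)
    (u : Plane → EuclideanSpace ℂ (Fin 2)) (p : Plane → ℂ)
    (hup : IsOscillatoryStokes (k : ℂ) E u p)
    (hdecay : Filter.Tendsto (fun r : ℝ => circleArcIntegral (fun y => ‖u y‖ ^ 2) r)
      Filter.atTop (nhds 0)) :
    ∀ j : Fin 2, InnerProductSpace.HarmonicOnNhd (fun x : Plane => u x j) E := by
  intro j
  have hEo : IsOpen E := by rw [hE, exteriorOf]; exact isClosed_closure.isOpen_compl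
  obtain ⟨R, hR, hRE⟩ := exists_forall_norm_gt_mem_exteriorOf hΩ_bdd
  rw [← hE] at hRE
  have hRE' : ∀ r > R, ∀ θ, r • radialDir θ ∈ E := fun r hr θ => hRE _ (by
    rwa [norm_smul, norm_radialDir, mul_one, Real.norm_of_nonneg (hR.trans hr.le)])
  have hRE0 : ∀ r > R, ∀ θ, (0 : Plane) + r • radialDir θ ∈ E := fun r hr θ => by
    rw [zero_add]; exact hRE' r hr θ
  have hkC : (k : ℂ) ^ 2 ≠ 0 := pow_ne_zero 2 (Complex.ofReal_ne_zero.2 hk)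
  have hp := hup.harmonicOnNhd_partialDeriv_pressure hEo j
  have hh : InnerProductSpace.HarmonicOnNhd (((k : ℂ) ^ 2)⁻¹ • partialDeriv j p) E :=
    fun x hx => (hp x hx).comp_CLM (ContinuousLinearMap.mul ℝ ℂ ((k : ℂ) ^ 2)⁻¹)
  set h := ((k : ℂ) ^ 2)⁻¹ • partialDeriv j p with hdef
  have hu := hup.contDiffOn_component j
  set uj : Plane → ℂ := fun x => u x j with huj
  have hhH : IsHelmholtz 0 E h := ⟨hh.contDiffOn, fun x hx => by
    simpa using (hh x hx).2.self_of_nhds⟩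
  have hlap : ∀ x ∈ E, Laplacian.laplacian uj x = -((k : ℂ) ^ 2 * (uj - h) x) := fun x hx => by
    have h1 := hup.momentum x hx j
    have h2 : (k : ℂ) ^ 2 * h x = partialDeriv j p x := by
      rw [hdef, Pi.smul_apply, smul_eq_mul, mul_inv_cancel_left₀ hkC]
    rw [Pi.sub_apply, mul_sub, h2, ← h1]
    ring
  have hw : IsHelmholtz (k ^ 2) E (uj - h) := ⟨hu.sub hh.contDiffOn, fun x hx => by
    rw [(hu.contDiffAt (hEo.mem_nhds hx)).laplacian_sub (hh x hx).1, hlap x hx,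
      (hh x hx).2.self_of_nhds, Pi.zero_apply]
    push_cast
    ring⟩
  -- The two pieces add up to u_j, whose modes are o(r^{-1/2}) by the decay hypothesis.
  have hw0 := hw.eq_zero_of_tendsto_angularMode_add hR hk hEo hRE0 hhH fun n => by
    refine (tendsto_sqrt_mul_norm_angularMode hup.contDiffOn_velocity.continuousOn hRE'
      hdecay j n).congr' ?_
    filter_upwards [eventually_gt_atTop R] with r hr
    rw [← angularMode_add hw.contDiffOn.continuousOn hhH.contDiffOn.continuousOn (hRE0 r hr)]
    simp [huj]
  have hwE : ∀ x ∈ E, (uj - h) x = 0 := by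
    -- A base point outside the disc, near which w vanishes, for the unique continuation.
    have hnorm : R < ‖(R + 1) • radialDir 0‖ := by
      rw [norm_smul, norm_radialDir, mul_one, Real.norm_of_nonneg (by linarith)]
      linarith
    refine hw.eq_zero_of_eventually hEo hE_conn.isPreconnected (hRE _ hnorm) ?_
    filter_upwards [continuous_norm.continuousAt.eventually (lt_mem_nhds hnorm)] with x hx
      using hw0 x hx
  intro x hx
  refine ⟨hu.contDiffAt (hEo.mem_nhds hx), ?_⟩
  filter_upwards [hEo.mem_nhds hx] with y hy
  rw [hlap y hy, hwE y hy, mul_zero, neg_zero, Pi.zero_apply]
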